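/- Let $F$ be a finite 4-regular multigraph (loops and parallel edges allowed, $F$ not necessarily connected) with vertex set $V$. Each edge of $F$ consists of two half-edges, and each vertex is incident on exactly four half-edges. A circuit is a closed walk (up to cyclic permutation, with at least one edge) whose edges are pairwise distinct. A circuit partition $P$ of $F$ is a set of circuits such that every edge lies on exactly one of them. An Euler system of $F$ is a set of circuits consisting of one Euler circuit (a circuit containing every edge exactly once) of each connected component of $F$; in particular it is a circuit partition. The touch-graph $Tch(P)$ has the circuits of $P$ as vertices and one edge $e_v$ for each $v\in V$. The two half-edges of $e_v$ correspond to the two passages of circuits of $P$ through $v$, and each is incident on the circuit to which that passage belongs. For a directed version $D$ of $Tch(P)$, the cycle space of $Tch(P)$ over $\mathbb{R}$ is the subspace of $\mathbb{R}^{V}$ (edges identified with vertices of $F$ through $e_v\leftrightarrow v$) spanned by the vectors of closed walks $W$ of $Tch(P)$; the $v$ coordinate of the vector of $W$ is the number of times $W$ passes through $e_v$ in the direction of $D$ minus the number of times it does so in the opposite direction. The transition $P(v)$ of $P$ at $v$ is the pairing of the four half-edges at $v$ into consecutive half-edges on circuits of $P$. For an Euler system $C$, let $\phi_C(v)=C(v)$.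 If $C$ arrives at $v$ along $h_1,h_3$ and leaves along $h_2,h_4$, let $\psi_C(v)=\{\{h_1,h_3\},\{h_2,h_4\}\}$. Vertices $v\ne w$ are interlaced with respect to $C$ if they appear on a circuit of $C$ in the order $vwvw$ or $wvwv$. The matrix $M(C,P)$ is the $V\times V$ matrix over $GF(2)$ obtained from the interlacement matrix of $C$ (whose $vw$ entry is $1$ if $v,w$ are interlaced, and $0$ otherwise) as follows: for each $w$ with $P(w)=\phi_C(w)$, replace the $w$ column by the $w$ column of the identity matrix; for each $w$ with $P(w)=\psi_C(w)$, replace the $ww$ entry by $1$. Given a directed version $D$ of $Tch(P)$, an $M_{\mathbb{R}}(C,P)$ matrix (with respect to $D$) is a $V\times V$ matrix with integer entries that reduces modulo $2$ to $M(C,P)$ and whose row space over $\mathbb{R}$ is the cycle space of $Tch(P)$ over $\mathbb{R}$ with respect to $D$. Let $C$ and $C'$ be Euler systems of $F$. 1. Every $M_{\mathbb{R}}(C,C')$ matrix $M$ (with respect to any directed version of $Tch(C')$) is nonsingular, and $(\det M)\cdot M^{-1}$ is an $M_{\mathbb{R}}(C',C)$ matrix (with respect to every directed version of $Tch(C)$).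 2. Let $P$ be a circuit partition of $F$. If $M$ is an $M_{\mathbb{R}}(C',C)$ matrix (with respect to any directed version of $Tch(C)$) and $N$ is an $M_{\mathbb{R}}(C,P)$ matrix with respect to a directed version $D$ of $Tch(P)$, then $M\cdot N$ is an $M_{\mathbb{R}}(C',P)$ matrix with respect to $D$. -/

import Mathlib

/-- A multigraph with vertex set `V`, edge set `E` and set of half-edges `H`. Loops and parallel
edges are allowed. Each half-edge is incident on one vertex and belongs to one edge, and each
edge consists of two distinct half-edges. -/
structure HalfEdgeGraph (V E H : Type*) where
  vert : H → V
  edge : H → E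
  ncard_edge : ∀ e, {h | edge h = e}.ncard = 2

namespace HalfEdgeGraph

variable {V E H : Type*}

/-- Every vertex has degree `d`: it is incident on exactly `d` half-edges. -/
def IsRegular (G : HalfEdgeGraph V E H) (d : ℕ) : Prop :=
  ∀ v, {h | G.vert h = v}.ncard = d

/-- Two vertices are joined by an edge. -/
def Adj (G : HalfEdgeGraph V E H) (u v : V) : Prop :=
  ∃ h h', h ≠ h' ∧ G.edge h = G.edge h' ∧ G.vert h = u ∧ G.vert h' = v

/-- The connected components: the classes of the equivalence relation generated by adjacency. -/
def Component (G : HalfEdgeGraph V E H) : Type _ := Quot G.Adj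

/-- The connected component of a vertex. -/
def component (G : HalfEdgeGraph V E H) (v : V) : G.Component := Quot.mk G.Adj v

/-- A directed version of a graph: a choice of the initial half-edge of each edge. -/
structure Direction (G : HalfEdgeGraph V E H) where
  init : E → H
  edge_init : ∀ e, G.edge (init e) = e

/-- A closed walk with `n + 1` steps. Step `j` leaves a vertex along the half-edge `start j` and
arrives at a vertex along the other half-edge `finish j` of the same edge. The index set
`Fin (n + 1)` is cyclic (the successor of the last index is `0`). A closed walk up to cyclic
permutation is represented by any of its parametrizations. -/
structure ClosedWalk (G : HalfEdgeGraph V E H) where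
  n : ℕ
  start : Fin (n + 1) → H
  finish : Fin (n + 1) → H
  ne : ∀ j, start j ≠ finish j
  edge_eq : ∀ j, G.edge (start j) = G.edge (finish j)
  vert_eq : ∀ j, G.vert (finish j) = G.vert (start (j + 1))

namespace ClosedWalk

variable {G : HalfEdgeGraph V E H}

/-- The vertex at which the walk is between step `j` and step `j + 1`. -/
def visit (W : G.ClosedWalk) (j : Fin (W.n + 1)) : V := G.vert (W.finish j)

/-- The edge `e` appears on the walk. -/
def Traverses (W : G.ClosedWalk) (e : E) : Prop := ∃ j, G.edge (W.start j) = e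

/-- A circuit: a closed walk whose edges are pairwise distinct. -/
def IsCircuit (W : G.ClosedWalk) : Prop := Function.Injective fun j => G.edge (W.start j)

/-- A circuit in the connected component `K` in which every edge of `K` appears exactly once. -/
def IsEulerCircuitOf (W : G.ClosedWalk) (K : G.Component) : Prop :=
  W.IsCircuit ∧ ∀ h, G.component (G.vert h) = K ↔ W.Traverses (G.edge h)

open Classical in
/-- The vector of a closed walk with respect to a directed version `D` of the graph: the
coordinate of `e` is the number of times the walk passes through `e` in the `D` direction minus
the number of times it passes through `e` in the opposite direction. -/
noncomputable def vec (K : Type*) [Field K] (D : G.Direction) (W : G.ClosedWalk) : E → K :=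
  fun e => ∑ j, ((if W.start j = D.init e then 1 else 0) -
    (if W.finish j = D.init e then 1 else 0))

end ClosedWalk

/-- The cycle space over the field `K`, with respect to a directed version of the graph. -/
def cycleSpace (K : Type*) [Field K] {G : HalfEdgeGraph V E H} (D : G.Direction) :
    Submodule K (E → K) :=
  Submodule.span K (Set.range (ClosedWalk.vec K D))

/-- A circuit partition: a set of circuits such that every edge appears on exactly one of them.
(The circuits are given with an orientation and a starting point.) -/
structure CircuitPartition (G : HalfEdgeGraph V E H) where
  circuits : Set G.ClosedWalk
  isCircuit : ∀ c ∈ circuits, c.IsCircuit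
  existsUnique : ∀ e, ∃! c, c ∈ circuits ∧ c.Traverses e

/-- An Euler system: a set of Euler circuits of connected components, one in each component. -/
structure EulerSystem (G : HalfEdgeGraph V E H) where
  circuits : Set G.ClosedWalk
  isEuler : ∀ c ∈ circuits, ∃ K, c.IsEulerCircuitOf K
  existsUnique : ∀ K, ∃! c, c ∈ circuits ∧ c.IsEulerCircuitOf K

theorem exists_edge (G : HalfEdgeGraph V E H) (e : E) : ∃ h, G.edge h = e := by
  have h := G.ncard_edge e
  exact Set.nonempty_of_ncard_ne_zero (s := {h | G.edge h = e}) (by omega)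

/-- An Euler system is a circuit partition. -/
def EulerSystem.toCircuitPartition {G : HalfEdgeGraph V E H} (C : EulerSystem G) :
    CircuitPartition G where
  circuits := C.circuits
  isCircuit c hc := by
    obtain ⟨K, hK⟩ := C.isEuler c hc
    exact hK.1
  existsUnique e := by
    obtain ⟨h, rfl⟩ := G.exists_edge e
    obtain ⟨c, ⟨hc, hcK⟩, hu⟩ := C.existsUnique (G.component (G.vert h))
    refine ⟨c, ⟨hc, (hcK.2 h).1 rfl⟩, ?_⟩
    rintro c' ⟨hc', ht⟩
    obtain ⟨K, hK⟩ := C.isEuler c' hc'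
    have hKe := (hK.2 h).2 ht
    subst hKe
    exact hu c' ⟨hc', hK⟩

namespace CircuitPartition

variable {G : HalfEdgeGraph V E H}

/-- The passages of the circuits of `P` through vertices. The passage `⟨c, j⟩` takes place
between step `j` and step `j + 1` of the circuit `c`. -/
def Passage (P : CircuitPartition G) : Type _ := Σ c : P.circuits, Fin (c.1.n + 1)

namespace Passage

variable {P : CircuitPartition G}

/-- The vertex a passage goes through. -/
def vertex (p : P.Passage) : V := p.1.1.visit p.2

/-- The half-edge along which a passage arrives. -/
def arrive (p : P.Passage) : H := p.1.1.finish p.2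

/-- The half-edge along which a passage leaves. -/
def leave (p : P.Passage) : H := p.1.1.start (p.2 + 1)

theorem vert_arrive (p : P.Passage) : G.vert p.arrive = p.vertex := rfl

theorem vert_leave (p : P.Passage) : G.vert p.leave = p.vertex := (p.1.1.vert_eq p.2).symm

theorem eq_of_edge (c d : P.circuits) (i : Fin (c.1.n + 1)) (j : Fin (d.1.n + 1))
    (h : G.edge (c.1.start i) = G.edge (d.1.start j)) :
    (⟨c, i⟩ : P.Passage) = ⟨d, j⟩ := by
  obtain ⟨c, hc⟩ := c
  obtain ⟨d, hd⟩ := d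
  have hcd : c = d :=
    (P.existsUnique (G.edge (c.start i))).unique ⟨hc, i, rfl⟩ ⟨hd, j, h.symm⟩
  subst hcd
  have hij : i = j := P.isCircuit c hc h
  subst hij
  rfl

theorem arrive_injective : Function.Injective (arrive (P := P)) := by
  rintro ⟨c, i⟩ ⟨d, j⟩ h
  refine eq_of_edge c d i j ?_
  rw [c.1.edge_eq, d.1.edge_eq]
  exact congrArg G.edge h

theorem leave_injective : Function.Injective (leave (P := P)) := by
  rintro ⟨c, i⟩ ⟨d, j⟩ h
  have h1 := eq_of_edge c d (i + 1) (j + 1) (congrArg G.edge h)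
  have hcd : c = d := congrArg Sigma.fst h1
  subst hcd
  have h2 : i + 1 = j + 1 := eq_of_heq (Sigma.mk.inj h1).2
  rw [add_right_cancel h2]

theorem arrive_ne_leave (p q : P.Passage) : p.arrive ≠ q.leave := by
  obtain ⟨c, i⟩ := p
  obtain ⟨d, j⟩ := q
  intro h
  have h1 := eq_of_edge c d i (j + 1) (by rw [c.1.edge_eq]; exact congrArg G.edge h)
  have hcd : c = d := congrArg Sigma.fst h1
  subst hcd
  have h2 : i = j + 1 := eq_of_heq (Sigma.mk.inj h1).2
  subst h2
  exact c.1.ne _ h.symm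

theorem exists_arrive_or_leave (h : H) : ∃ p : P.Passage, p.arrive = h ∨ p.leave = h := by
  obtain ⟨c, ⟨hc, j, hj⟩, -⟩ := P.existsUnique (G.edge h)
  obtain ⟨x, y, -, hs⟩ := Set.ncard_eq_two.1 (G.ncard_edge (G.edge h))
  have m (z : H) (hz : G.edge z = G.edge h) : z = x ∨ z = y := by
    have : z ∈ ({x, y} : Set H) := hs ▸ hz
    simpa using this
  have h1 := m (c.start j) hj
  have h2 := m (c.finish j) ((c.edge_eq j).symm.trans hj)
  have h3 := m h rfl
  have h4 := c.ne j
  have h5 : c.finish j = h ∨ c.start j = h := by grind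
  rcases h5 with h5 | h5
  · exact ⟨⟨⟨c, hc⟩, j⟩, Or.inl h5⟩
  · refine ⟨⟨⟨c, hc⟩, j - 1⟩, Or.inr ?_⟩
    change c.start (j - 1 + 1) = h
    rw [sub_add_cancel, h5]

theorem ncard_vertex (hG : G.IsRegular 4) (v : V) :
    {p : P.Passage | p.vertex = v}.ncard = 2 := by
  set S := {p : P.Passage | p.vertex = v} with hS
  have hun : {h | G.vert h = v} = arrive '' S ∪ leave '' S := by
    ext h
    constructor
    · intro hh
      obtain ⟨p, rfl | rfl⟩ := exists_arrive_or_leave (P := P) h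
      · exact Or.inl ⟨p, hh, rfl⟩
      · exact Or.inr ⟨p, (vert_leave p).symm.trans hh, rfl⟩
    · rintro (⟨p, hp, rfl⟩ | ⟨p, hp, rfl⟩)
      · exact hp
      · exact (vert_leave p).trans hp
  have h4 := hG v
  have hfin : (arrive '' S ∪ leave '' S).Finite := by
    rw [← hun]
    exact Set.finite_of_ncard_ne_zero (by omega)
  have hd : Disjoint (arrive '' S) (leave '' S) := by
    rw [Set.disjoint_left]
    rintro _ ⟨p, -, rfl⟩ ⟨q, -, hq⟩
    exact arrive_ne_leave p q hq.symm
  rw [hun, Set.ncard_union_eq hd (hfin.subset Set.subset_union_left)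
    (hfin.subset Set.subset_union_right), Set.ncard_image_of_injective _ arrive_injective,
    Set.ncard_image_of_injective _ leave_injective] at h4
  omega

end Passage

/-- The touch-graph of a circuit partition `P` of a 4-regular graph. Its vertices are the circuits
of `P` and its edges are the vertices of `G`. The two half-edges of the edge `v` are the two
passages of circuits of `P` through `v`, each incident on the circuit it belongs to. -/
def touchGraph (P : CircuitPartition G) (hG : G.IsRegular 4) :
    HalfEdgeGraph P.circuits V P.Passage where
  vert p := p.1
  edge p := p.vertex
  ncard_edge := Passage.ncard_vertex hG

/-- The transition of `P` at `v`: the set of the pairs of half-edges at `v` that are consecutive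
on circuits of `P`. -/
def transition (P : CircuitPartition G) (v : V) : Set (Sym2 H) :=
  {t | ∃ p : P.Passage, p.vertex = v ∧ t = s(p.arrive, p.leave)}

end CircuitPartition

namespace EulerSystem

open CircuitPartition

variable {G : HalfEdgeGraph V E H}

/-- The transition `φ_C(v)`, which follows the circuit of `C` incident on `v`. -/
def phi (C : EulerSystem G) (v : V) : Set (Sym2 H) := C.toCircuitPartition.transition v

/-- The transition `ψ_C(v)`, which is not consistent with an orientation of the circuit of `C`
incident on `v`: it pairs the two half-edges along which the circuit arrives at `v`, and it pairs
the two half-edges along which the circuit leaves `v`. -/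
def psi (C : EulerSystem G) (v : V) : Set (Sym2 H) :=
  {t | ∃ p q : C.toCircuitPartition.Passage, p ≠ q ∧ p.vertex = v ∧ q.vertex = v ∧
    (t = s(p.arrive, q.arrive) ∨ t = s(p.leave, q.leave))}

/-- Two vertices `v ≠ w` are interlaced if some circuit of `C` visits them in the order
`vwvw` or `wvwv`. -/
def Interlaced (C : EulerSystem G) (v w : V) : Prop :=
  v ≠ w ∧ ∃ c ∈ C.circuits, ∃ i j k l : Fin (c.n + 1), i < j ∧ j < k ∧ k < l ∧
    ((c.visit i = v ∧ c.visit j = w ∧ c.visit k = v ∧ c.visit l = w) ∨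
      (c.visit i = w ∧ c.visit j = v ∧ c.visit k = w ∧ c.visit l = v))

open Classical in
/-- The interlacement matrix of an Euler system, with entries in `GF(2)`. -/
noncomputable def interlacementMatrix (C : EulerSystem G) : Matrix V V (ZMod 2) :=
  Matrix.of fun v w => if C.Interlaced v w then 1 else 0

open Classical in
/-- The modified interlacement matrix `M(C, P)`, with entries in `GF(2)`. It is obtained from the
interlacement matrix as follows. If `P` involves `φ_C(w)`, the `w` column is replaced by the
`w` column of the identity matrix. If `P` involves `ψ_C(w)`, the `ww` entry is replaced by `1`. -/
noncomputable def modifiedMatrix (C : EulerSystem G) (P : CircuitPartition G) :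
    Matrix V V (ZMod 2) :=
  Matrix.of fun v w =>
    if P.transition w = C.phi w then (if v = w then 1 else 0)
    else if P.transition w = C.psi w ∧ v = w then 1
    else C.interlacementMatrix v w

/-- `M` is an `M_ℝ(C, P)` matrix, with respect to a directed version `D` of the touch-graph of `P`:
its entries are integers, it reduces modulo `2` to `M(C, P)`, and its row space is the cycle space
of the touch-graph over `ℝ`. -/
def IsRealMatrix {G : HalfEdgeGraph V E H} (hG : G.IsRegular 4) (C : EulerSystem G)
    (P : CircuitPartition G) (D : (P.touchGraph hG).Direction) (M : Matrix V V ℝ) : Prop :=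
  (∃ N : Matrix V V ℤ, N.map (Int.cast : ℤ → ℝ) = M ∧
    N.map (Int.cast : ℤ → ZMod 2) = C.modifiedMatrix P) ∧
  Submodule.span ℝ (Set.range M.row) = cycleSpace ℝ D

end EulerSystem

end HalfEdgeGraph

namespace HalfEdgeGraph

variable {V E H : Type*} {G : HalfEdgeGraph V E H}

/-! Everything rests on the identity M(C',C)·M(C,P) = M(C',P) over GF(2), `modifiedMatrix_mul`. Call
a vector z on the edges even if it sums to 0 over the half-edges at each vertex. For an even z, the
sum of z over a passage of P at v does not depend on which of the two passages is used; these sums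
form a linear map `turn` for P. Row v of M(C,P) is the `turn` for P of the segment of C between its
two visits to v (`modifiedMatrix_eq_turn`). If the `turn` of z for C vanishes, z is constant on each
Euler circuit, hence its `turn` for any P vanishes (`turn_eq_zero`). So the `turn` for P is the
`turn` for C times M(C,P), and applying this to segments of C' gives the identity.

Over ℝ, the touch-graph of an Euler system has only loops, so its cycle space is all of ℝ^V and the
row-space condition for it means nonsingularity. Then det M · M⁻¹ is the adjugate, which is integral
and reduces modulo 2 to the inverse of M(C,C'), namely M(C',C). In a product M·N the invertible left
factor keeps the row space of N. -/

theorem IsRegular.finite_vert {d : ℕ} (hG : G.IsRegular d) (hd : d ≠ 0) (v : V) :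
    {h | G.vert h = v}.Finite :=
  Set.finite_of_ncard_ne_zero (by rw [hG v]; exact hd)

/-- The vectors over `GF(2)` of the edge sets that contain an even number of the half-edges
incident on each vertex. -/
noncomputable def evenSpace (hG : G.IsRegular 4) : Submodule (ZMod 2) (E → ZMod 2) :=
  ⨅ v, LinearMap.ker (∑ h ∈ (hG.finite_vert (by norm_num) v).toFinset,
    (LinearMap.proj (G.edge h) : (E → ZMod 2) →ₗ[ZMod 2] ZMod 2))

theorem mem_evenSpace (hG : G.IsRegular 4) (z : E → ZMod 2) :
    z ∈ evenSpace hG ↔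
      ∀ v, ∑ h ∈ (hG.finite_vert (by norm_num) v).toFinset, z (G.edge h) = 0 := by
  simp [evenSpace, LinearMap.sum_apply]

/-! ### Passages at a vertex, even vectors and turns -/

namespace CircuitPartition

variable {P : CircuitPartition G}

theorem Passage.exists_pair (hG : G.IsRegular 4) (P : CircuitPartition G) (v : V) :
    ∃ p q : P.Passage, p ≠ q ∧ p.vertex = v ∧ q.vertex = v ∧
      ∀ r : P.Passage, r.vertex = v → r = p ∨ r = q := by
  obtain ⟨p, q, hpq, h⟩ := Set.ncard_eq_two.1 (Passage.ncard_vertex (P := P) hG v)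
  have key (r : P.Passage) : r.vertex = v ↔ r = p ∨ r = q := by
    simpa using Set.ext_iff.1 h r
  exact ⟨p, q, hpq, (key p).2 (Or.inl rfl), (key q).2 (Or.inr rfl), fun r => (key r).1⟩

theorem Passage.eq_or_eq (hG : G.IsRegular 4) {p q r : P.Passage} (hpq : p ≠ q)
    (h : p.vertex = q.vertex) (hr : r.vertex = q.vertex) : r = p ∨ r = q := by
  obtain ⟨p', q', -, -, -, h'⟩ := Passage.exists_pair hG P q.vertex
  have := h' p h
  have := h' q rfl
  have := h' r hr
  grind

theorem Passage.exists_ne (hG : G.IsRegular 4) (p : P.Passage) :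
    ∃ q : P.Passage, p ≠ q ∧ p.vertex = q.vertex := by
  obtain ⟨p', q', hne, hp, hq, h⟩ := Passage.exists_pair hG P p.vertex
  rcases h p rfl with rfl | rfl
  · exact ⟨q', hne, hq.symm⟩
  · exact ⟨p', hne.symm, hp.symm⟩

theorem Passage.halfEdge_cases (hG : G.IsRegular 4) {p q : P.Passage} (hpq : p ≠ q)
    (h : p.vertex = q.vertex) {x : H} (hx : G.vert x = q.vertex) :
    x = p.arrive ∨ x = p.leave ∨ x = q.arrive ∨ x = q.leave := by
  obtain ⟨r, rfl | rfl⟩ := Passage.exists_arrive_or_leave (P := P) x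
  · rcases Passage.eq_or_eq hG hpq h (r := r) hx with rfl | rfl <;> simp
  · rw [Passage.vert_leave] at hx
    rcases Passage.eq_or_eq hG hpq h hx with rfl | rfl <;> simp

theorem Passage.sum_halfEdges (hG : G.IsRegular 4) {p q : P.Passage} (hpq : p ≠ q)
    (h : p.vertex = q.vertex) (f : H → ZMod 2) :
    ∑ x ∈ (hG.finite_vert (by norm_num) q.vertex).toFinset, f x =
      f p.arrive + f p.leave + f q.arrive + f q.leave := by
  classical
  have hs : (hG.finite_vert (by norm_num) q.vertex).toFinset =
      {p.arrive, p.leave, q.arrive, q.leave} := by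
    ext x
    simp only [Set.Finite.mem_toFinset, Set.mem_ofPred_eq, Finset.mem_insert,
      Finset.mem_singleton]
    refine ⟨Passage.halfEdge_cases hG hpq h, ?_⟩
    rintro (rfl | rfl | rfl | rfl)
    · exact h
    · exact (Passage.vert_leave p).trans h
    · rfl
    · exact Passage.vert_leave q
  have h1 := Passage.arrive_injective.ne hpq
  have h2 := Passage.leave_injective.ne hpq
  have h3 := Passage.arrive_ne_leave p p
  have h4 := Passage.arrive_ne_leave p q
  have h5 := Passage.arrive_ne_leave q p
  have h6 := Passage.arrive_ne_leave q q
  rw [hs, Finset.sum_insert (by simp [*]), Finset.sum_insert (by simp [h2, h5.symm]),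
    Finset.sum_insert (by simp [*]), Finset.sum_singleton]
  ring

/-- Evenness of an edge vector in terms of the passages of a circuit partition. -/
theorem mem_evenSpace_iff (hG : G.IsRegular 4) (P : CircuitPartition G) (z : E → ZMod 2) :
    z ∈ evenSpace hG ↔ ∀ p q : P.Passage, p ≠ q → p.vertex = q.vertex →
      z (G.edge p.arrive) + z (G.edge p.leave) = z (G.edge q.arrive) + z (G.edge q.leave) := by
  have key (a b c d : ZMod 2) : a + b + c + d = 0 ↔ a + b = c + d := by
    revert a b c d; decide
  rw [mem_evenSpace]
  constructor
  · intro hz p q hpq h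
    have := hz q.vertex
    rwa [Passage.sum_halfEdges hG hpq h (fun x => z (G.edge x)), key] at this
  · intro hz v
    obtain ⟨p, q, hpq, hp, rfl, -⟩ := Passage.exists_pair hG P v
    rw [Passage.sum_halfEdges hG hpq hp (fun x => z (G.edge x)), key]
    exact hz p q hpq hp

theorem transition_eq (hG : G.IsRegular 4) {p q : P.Passage} (hpq : p ≠ q)
    (h : p.vertex = q.vertex) :
    P.transition q.vertex = {s(p.arrive, p.leave), s(q.arrive, q.leave)} := by
  ext t
  simp only [transition, Set.mem_ofPred_eq, Set.mem_insert_iff, Set.mem_singleton_iff]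
  constructor
  · rintro ⟨r, hr, rfl⟩
    rcases Passage.eq_or_eq hG hpq h hr with rfl | rfl <;> simp
  · rintro (rfl | rfl)
    · exact ⟨p, h, rfl⟩
    · exact ⟨q, rfl, rfl⟩

/-- The coordinate at `v` of the image of an edge vector `z` is the number modulo `2` of the
half-edges of a passage of `P` at `v` that belong to the edges counted by `z`. -/
noncomputable def turn (hG : G.IsRegular 4) (P : CircuitPartition G) :
    (E → ZMod 2) →ₗ[ZMod 2] (V → ZMod 2) :=
  LinearMap.pi fun v =>
    (LinearMap.proj (G.edge (Passage.exists_pair hG P v).choose.arrive) :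
        (E → ZMod 2) →ₗ[ZMod 2] ZMod 2) +
      LinearMap.proj (G.edge (Passage.exists_pair hG P v).choose.leave)

/-- Evenness makes the two passages at a vertex have equal sums, so the arbitrary passage chosen in
`turn` is immaterial. -/
theorem turn_apply (hG : G.IsRegular 4) {z : E → ZMod 2} (hz : z ∈ evenSpace hG)
    (p : P.Passage) :
    turn hG P z p.vertex = z (G.edge p.arrive) + z (G.edge p.leave) := by
  obtain ⟨q, -, h, -, -⟩ := (Passage.exists_pair hG P p.vertex).choose_spec
  change z (G.edge (Passage.exists_pair hG P p.vertex).choose.arrive) +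
    z (G.edge (Passage.exists_pair hG P p.vertex).choose.leave) = _
  by_cases hp : (Passage.exists_pair hG P p.vertex).choose = p
  · rw [hp]
  · exact (mem_evenSpace_iff hG P z).1 hz _ _ hp h

end CircuitPartition

open CircuitPartition

/-! ### The three transitions at a vertex -/

/-- The three ways to pair four elements. -/
theorem pairing_cases {α : Type*} {a b c d x y u w : α} (f : α → ZMod 2)
    (hf : f a + f b = f c + f d)
    (hxy : x ≠ y) (hxu : x ≠ u) (hxw : x ≠ w) (hyu : y ≠ u) (hyw : y ≠ w) (huw : u ≠ w)
    (hx : x = a ∨ x = b ∨ x = c ∨ x = d) (hy : y = a ∨ y = b ∨ y = c ∨ y = d)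
    (hu : u = a ∨ u = b ∨ u = c ∨ u = d) (hw : w = a ∨ w = b ∨ w = c ∨ w = d) :
    (({s(x, y), s(u, w)} : Set (Sym2 α)) = {s(a, b), s(c, d)} ∧ f x + f y = f a + f b) ∨
    (({s(x, y), s(u, w)} : Set (Sym2 α)) = {s(a, c), s(b, d)} ∧ f x + f y = f a + f c) ∨
    (({s(x, y), s(u, w)} : Set (Sym2 α)) = {s(a, d), s(b, c)} ∧ f x + f y = f a + f d) := by
  have key (a b c d : ZMod 2) (h : a + b = c + d) : a + c = b + d ∧ a + d = b + c := by
    revert a b c d; decide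
  obtain ⟨h1, h2⟩ := key _ _ _ _ hf
  -- Distinctness discards all but the 24 arrangements of the four elements; each is one of three
  -- pairings, and `f` has equal sums on both blocks of a pairing.
  rcases hx with rfl | rfl | rfl | rfl <;> rcases hy with rfl | rfl | rfl | rfl <;>
    first
    | exact absurd rfl hxy
    | (rcases hu with rfl | rfl | rfl | rfl <;>
        first
        | exact absurd rfl hxu
        | exact absurd rfl hyu
        | (rcases hw with rfl | rfl | rfl | rfl <;>
            first
            | exact absurd rfl hxw
            | exact absurd rfl hyw
            | exact absurd rfl huw
            | grind [Sym2.eq_swap, Set.pair_comm]))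

namespace EulerSystem

variable {C : EulerSystem G}

theorem psi_eq (hG : G.IsRegular 4) {p q : C.toCircuitPartition.Passage} (hpq : p ≠ q)
    (h : p.vertex = q.vertex) :
    C.psi q.vertex = {s(p.arrive, q.arrive), s(p.leave, q.leave)} := by
  ext t
  simp only [psi, Set.mem_ofPred_eq, Set.mem_insert_iff, Set.mem_singleton_iff]
  constructor
  · rintro ⟨r, r', hne, hr, hr', ht⟩
    rcases Passage.eq_or_eq hG hpq h hr with rfl | rfl <;>
      rcases Passage.eq_or_eq hG hpq h hr' with rfl | rfl
    · exact absurd rfl hne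
    · exact ht
    · rwa [Sym2.eq_swap, Sym2.eq_swap (a := Passage.leave _)] at ht
    · exact absurd rfl hne
  · intro ht
    exact ⟨p, q, hpq, h, rfl, ht⟩

-- By evenness the turn is the sum over whichever block of the transition contains `p.arrive`. The
-- three cases are the possible partners of `p.arrive`, which are distinct half-edges, so the cases
-- exclude one another.
open Classical in
theorem turn_eq_ite (hG : G.IsRegular 4) (P : CircuitPartition G) {z : E → ZMod 2}
    (hz : z ∈ evenSpace hG) {p q : C.toCircuitPartition.Passage} (hpq : p ≠ q)
    (h : p.vertex = q.vertex) :
    turn hG P z q.vertex =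
      if P.transition q.vertex = C.phi q.vertex then
        z (G.edge p.arrive) + z (G.edge p.leave)
      else if P.transition q.vertex = C.psi q.vertex then
        z (G.edge p.arrive) + z (G.edge q.arrive)
      else z (G.edge p.arrive) + z (G.edge q.leave) := by
  obtain ⟨r, t, hrt, hr, ht, -⟩ := Passage.exists_pair hG P q.vertex
  have hv : r.vertex = t.vertex := hr.trans ht.symm
  have h1 := Passage.arrive_injective.ne hpq
  have h2 := Passage.leave_injective.ne hpq
  have h3 := Passage.arrive_ne_leave p p
  have h4 := Passage.arrive_ne_leave p q
  have h5 := Passage.arrive_ne_leave q p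
  have h6 := Passage.arrive_ne_leave q q
  have hphi : C.phi q.vertex = {s(p.arrive, p.leave), s(q.arrive, q.leave)} :=
    transition_eq hG hpq h
  have hpsi := psi_eq hG hpq h
  have htr : P.transition q.vertex = {s(r.arrive, r.leave), s(t.arrive, t.leave)} := by
    rw [← ht]; exact transition_eq hG hrt hv
  have hturn : turn hG P z q.vertex = z (G.edge r.arrive) + z (G.edge r.leave) := by
    rw [← hr]; exact turn_apply hG hz r
  have cases4 {x : H} (hx : G.vert x = q.vertex) := Passage.halfEdge_cases hG hpq h hx
  have hb := (mem_evenSpace_iff hG C.toCircuitPartition z).1 hz p q hpq h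
  rcases pairing_cases (fun x => z (G.edge x)) hb
    (Passage.arrive_ne_leave r r) (Passage.arrive_injective.ne hrt)
    (Passage.arrive_ne_leave r t) (Passage.arrive_ne_leave t r).symm
    (Passage.leave_injective.ne hrt) (Passage.arrive_ne_leave t t)
    (cases4 hr) (cases4 ((Passage.vert_leave r).trans hr)) (cases4 ht)
    (cases4 ((Passage.vert_leave t).trans ht)) with ⟨hc, hs⟩ | ⟨hc, hs⟩ | ⟨hc, hs⟩
  · rw [if_pos (by rw [htr, hc, hphi]), hturn]
    exact hs
  · rw [if_neg, if_pos (by rw [htr, hc, hpsi]), hturn]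
    · exact hs
    · rw [htr, hc, hphi]
      intro he
      have : s(p.arrive, q.arrive) ∈
          ({s(p.arrive, p.leave), s(q.arrive, q.leave)} : Set (Sym2 H)) := by
        rw [← he]; simp
      simp [h1, h3, h4, h5] at this
  · rw [if_neg, if_neg, hturn]
    · exact hs
    · rw [htr, hc, hpsi]
      intro he
      have : s(p.arrive, q.leave) ∈
          ({s(p.arrive, q.arrive), s(p.leave, q.leave)} : Set (Sym2 H)) := by
        rw [← he]; simp
      simp [h1, h3, h4, h6.symm] at this
    · rw [htr, hc, hphi]
      intro he
      have : s(p.arrive, q.leave) ∈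
          ({s(p.arrive, p.leave), s(q.arrive, q.leave)} : Set (Sym2 H)) := by
        rw [← he]; simp
      simp [h1, h3, h4, h2.symm] at this

/-- All passages of an Euler system through a vertex belong to the same circuit. -/
theorem circuit_eq {p q : C.toCircuitPartition.Passage} (h : p.vertex = q.vertex) :
    p.1 = q.1 := by
  obtain ⟨K, hK⟩ := C.isEuler p.1.1 p.1.2
  obtain ⟨L, hL⟩ := C.isEuler q.1.1 q.1.2
  have h1 : G.component p.vertex = K := (hK.2 p.arrive).2 ⟨p.2, p.1.1.edge_eq p.2⟩
  have h2 : G.component q.vertex = L := (hL.2 q.arrive).2 ⟨q.2, q.1.1.edge_eq q.2⟩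
  have hKL : K = L := by rw [← h1, ← h2, h]
  subst hKL
  exact Subtype.ext ((C.existsUnique K).unique ⟨p.1.2, hK⟩ ⟨q.1.2, hL⟩)

theorem exists_visits (hG : G.IsRegular 4) (C : EulerSystem G) (v : V) :
    ∃ (c : C.toCircuitPartition.circuits) (i j : Fin (c.1.n + 1)), i < j ∧
      c.1.visit i = v ∧ c.1.visit j = v ∧
      ∀ r : C.toCircuitPartition.Passage, r.vertex = v → r = ⟨c, i⟩ ∨ r = ⟨c, j⟩ := by
  obtain ⟨⟨c, i⟩, ⟨d, j⟩, hpq, hp, hq, h⟩ := Passage.exists_pair hG C.toCircuitPartition v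
  obtain rfl : c = d := circuit_eq (hp.trans hq.symm)
  have hij : i ≠ j := fun hij => hpq (by rw [hij])
  rcases lt_or_gt_of_ne hij with hij | hij
  · exact ⟨c, i, j, hij, hp, hq, h⟩
  · exact ⟨c, j, i, hij, hq, hp, fun r hr => (h r hr).symm⟩

end EulerSystem

/-! ### Segments of circuits and interlacement -/

open Classical in
/-- The edge vector over `GF(2)` of the part of a closed walk from the visit `i` to the
visit `j`. -/
noncomputable def ClosedWalk.segment (c : G.ClosedWalk) (i j : Fin (c.n + 1)) : E → ZMod 2 :=
  -- Visit `i` comes after step `i`, so the steps between visits `i` and `j` are `i + 1, …, j`.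
  fun e => if ∃ k, i < k ∧ k ≤ j ∧ G.edge (c.start k) = e then 1 else 0

namespace CircuitPartition

variable {P : CircuitPartition G}

open Classical in
theorem segment_arrive (c : P.circuits) (i j k : Fin (c.1.n + 1)) :
    c.1.segment i j (G.edge (Passage.arrive (P := P) ⟨c, k⟩)) =
      if i < k ∧ k ≤ j then 1 else 0 := by
  have he : G.edge (Passage.arrive (P := P) ⟨c, k⟩) = G.edge (c.1.start k) :=
    (c.1.edge_eq k).symm
  rw [ClosedWalk.segment, he]
  refine if_congr ⟨?_, fun h => ⟨k, h.1, h.2, rfl⟩⟩ rfl rfl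
  rintro ⟨l, h1, h2, h3⟩
  obtain rfl : l = k := P.isCircuit c.1 c.2 h3
  exact ⟨h1, h2⟩

open Classical in
theorem segment_leave (c : P.circuits) (i j k : Fin (c.1.n + 1)) :
    c.1.segment i j (G.edge (Passage.leave (P := P) ⟨c, k⟩)) =
      if i ≤ k ∧ k < j then 1 else 0 := by
  have h1 : c.1.segment i j (G.edge (Passage.leave (P := P) ⟨c, k⟩)) =
      if i < k + 1 ∧ k + 1 ≤ j then 1 else 0 := by
    rw [← segment_arrive (P := P) c i j (k + 1)]
    exact congrArg _ (c.1.edge_eq (k + 1))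
  rw [h1]
  refine if_congr ?_ rfl rfl
  have hj := j.isLt
  have hk := k.isLt
  -- At the last index `k + 1` wraps around to `0`, and both conditions are false.
  rcases (Fin.le_last k).eq_or_lt with rfl | hlt
  · simp only [Fin.last_add_one, Fin.lt_def, Fin.le_def, Fin.val_zero, Fin.val_last]
    omega
  · have := Fin.val_add_one_of_lt hlt
    simp only [Fin.lt_def, Fin.le_def, this]
    omega

theorem segment_of_ne {c d : P.circuits} (hcd : d ≠ c) (i j : Fin (c.1.n + 1))
    (k : Fin (d.1.n + 1)) : c.1.segment i j (G.edge (d.1.start k)) = 0 := by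
  rw [ClosedWalk.segment, if_neg]
  rintro ⟨l, -, -, h⟩
  exact hcd (congrArg Sigma.fst (Passage.eq_of_edge d c k l h.symm))

theorem segment_arrive_of_ne {c d : P.circuits} (hcd : d ≠ c) (i j : Fin (c.1.n + 1))
    (k : Fin (d.1.n + 1)) :
    c.1.segment i j (G.edge (Passage.arrive (P := P) ⟨d, k⟩)) = 0 := by
  rw [← segment_of_ne hcd i j k]
  exact congrArg _ (d.1.edge_eq k).symm

theorem segment_leave_of_ne {c d : P.circuits} (hcd : d ≠ c) (i j : Fin (c.1.n + 1))
    (k : Fin (d.1.n + 1)) :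
    c.1.segment i j (G.edge (Passage.leave (P := P) ⟨d, k⟩)) = 0 :=
  segment_of_ne hcd i j (k + 1)

end CircuitPartition

namespace EulerSystem

variable {C : EulerSystem G}

/-- Away from the vertex at which it begins and ends, a segment of a circuit contains both
half-edges of a passage, or neither. -/
theorem segment_arrive_eq_leave (c : C.toCircuitPartition.circuits) {i j : Fin (c.1.n + 1)}
    {v : V} (hi : c.1.visit i = v) (hj : c.1.visit j = v) (p : C.toCircuitPartition.Passage)
    (hp : p.vertex ≠ v) :
    c.1.segment i j (G.edge p.arrive) = c.1.segment i j (G.edge p.leave) := by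
  obtain ⟨d, k⟩ := p
  by_cases hdc : d = c
  · subst hdc
    rw [segment_arrive, segment_leave]
    refine if_congr ?_ rfl rfl
    have h1 : k ≠ i := by rintro rfl; exact hp hi
    have h2 : k ≠ j := by rintro rfl; exact hp hj
    grind
  · rw [segment_arrive_of_ne hdc, segment_leave_of_ne hdc]

/-- At `v` the segment uses exactly one half-edge of each passage: it leaves at visit `i` and
arrives at visit `j`. At any other vertex each passage contributes 0. -/
theorem segment_mem_evenSpace (hG : G.IsRegular 4) (c : C.toCircuitPartition.circuits)
    {i j : Fin (c.1.n + 1)} (hij : i < j) {v : V} (hi : c.1.visit i = v)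
    (hj : c.1.visit j = v) : c.1.segment i j ∈ evenSpace hG := by
  rw [mem_evenSpace_iff hG C.toCircuitPartition]
  intro p q hpq h
  by_cases hq : q.vertex = v
  · have hne : (⟨c, i⟩ : C.toCircuitPartition.Passage) ≠ ⟨c, j⟩ := fun he =>
      hij.ne (eq_of_heq (Sigma.mk.inj he).2)
    have hv : Passage.vertex (P := C.toCircuitPartition) ⟨c, i⟩ =
      Passage.vertex (P := C.toCircuitPartition) ⟨c, j⟩ := hi.trans hj.symm
    have h1 := Passage.eq_or_eq hG hne hv (r := q) (hq.trans hj.symm)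
    have h2 := Passage.eq_or_eq hG hne hv (r := p) ((h.trans hq).trans hj.symm)
    rcases h1 with rfl | rfl <;> rcases h2 with rfl | rfl <;>
      simp [segment_arrive, segment_leave, hij, hij.le]
  · rw [segment_arrive_eq_leave c hi hj q hq, segment_arrive_eq_leave c hi hj p (h ▸ hq),
      CharTwo.add_self_eq_zero, CharTwo.add_self_eq_zero]

open Classical in
/-- Segments of the circuits of an Euler system describe interlacement. -/
theorem interlacementMatrix_eq_segment (hG : G.IsRegular 4)
    (c : C.toCircuitPartition.circuits)
    {i j : Fin (c.1.n + 1)} (hij : i < j) {v : V} (hi : c.1.visit i = v)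
    (hj : c.1.visit j = v) {p q : C.toCircuitPartition.Passage} (hpq : p ≠ q)
    (h : p.vertex = q.vertex) (hv : v ≠ q.vertex) :
    C.interlacementMatrix v q.vertex =
      c.1.segment i j (G.edge p.arrive) + c.1.segment i j (G.edge q.arrive) := by
  have hne : (⟨c, i⟩ : C.toCircuitPartition.Passage) ≠ ⟨c, j⟩ := fun he =>
    hij.ne (eq_of_heq (Sigma.mk.inj he).2)
  have hvv : Passage.vertex (P := C.toCircuitPartition) ⟨c, i⟩ =
    Passage.vertex (P := C.toCircuitPartition) ⟨c, j⟩ := hi.trans hj.symm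
  obtain ⟨d, k⟩ := p
  obtain ⟨d', l⟩ := q
  obtain rfl : d = d' := circuit_eq h
  have hkl : k ≠ l := fun hkl => hpq (by rw [hkl])
  have atv {b : G.ClosedWalk} (hb : b ∈ C.circuits) {m : Fin (b.n + 1)} (hm : b.visit m = v) :=
    Passage.eq_or_eq hG hne hvv (r := ⟨⟨b, hb⟩, m⟩) (hm.trans hj.symm)
  have atw {b : G.ClosedWalk} (hb : b ∈ C.circuits) {m : Fin (b.n + 1)}
      (hm : b.visit m = d.1.visit l) :=
    Passage.eq_or_eq hG hpq h (r := ⟨⟨b, hb⟩, m⟩) hm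
  change (if C.Interlaced v (d.1.visit l) then (1 : ZMod 2) else 0) = _
  by_cases hdc : d = c
  · subst hdc
    have ev {m : Fin (d.1.n + 1)} (hm : d.1.visit m = v) : m = i ∨ m = j := by
      rcases atv d.2 hm with h | h
      · exact Or.inl (eq_of_heq (Sigma.mk.inj h).2)
      · exact Or.inr (eq_of_heq (Sigma.mk.inj h).2)
    have ew {m : Fin (d.1.n + 1)} (hm : d.1.visit m = d.1.visit l) : m = k ∨ m = l := by
      rcases atw d.2 hm with h | h
      · exact Or.inl (eq_of_heq (Sigma.mk.inj h).2)
      · exact Or.inr (eq_of_heq (Sigma.mk.inj h).2)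
    have hk : d.1.visit k = d.1.visit l := h
    have hv' : v ≠ d.1.visit l := hv
    have n1 : k ≠ i := by rintro rfl; exact hv' (hi.symm.trans hk)
    have n2 : k ≠ j := by rintro rfl; exact hv' (hj.symm.trans hk)
    have n3 : l ≠ i := by rintro rfl; exact hv' hi.symm
    have n4 : l ≠ j := by rintro rfl; exact hv' hj.symm
    -- Interlacement means that exactly one of the two visits `k`, `l` lies in the segment; since
    -- neither equals `i` or `j`, strictness of the inequalities does not matter.
    have key : C.Interlaced v (d.1.visit l) ↔
        ((i < k ∧ k ≤ j) ∧ ¬ (i < l ∧ l ≤ j)) ∨ (¬ (i < k ∧ k ≤ j) ∧ (i < l ∧ l ≤ j)) := by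
      constructor
      · rintro ⟨-, b, hb, x, y, z, w, hxy, hyz, hzw, hvis⟩
        have hbd : b = d.1 := by
          have : ∃ m, b.visit m = v := by
            rcases hvis with hh | hh
            · exact ⟨x, hh.1⟩
            · exact ⟨y, hh.2.1⟩
          obtain ⟨m, hm⟩ := this
          rcases atv hb hm with h | h <;> exact congrArg (fun r => r.1.1) h
        subst hbd
        rcases hvis with ⟨hx, hy, hz, hw⟩ | ⟨hx, hy, hz, hw⟩
        · have := ev hx; have := ew hy; have := ev hz; have := ew hw
          grind
        · have := ew hx; have := ev hy; have := ew hz; have := ev hw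
          grind
      · intro hh
        refine ⟨hv', d.1, d.2, ?_⟩
        rcases lt_or_gt_of_ne hkl with hlt | hlt
        · rcases hh with ⟨⟨h1, h2⟩, h3⟩ | ⟨h3, h1, h2⟩
          · exact ⟨i, k, j, l, h1, by grind, by grind, Or.inl ⟨hi, hk, hj, rfl⟩⟩
          · exact ⟨k, i, l, j, by grind, h1, by grind, Or.inr ⟨hk, hi, rfl, hj⟩⟩
        · rcases hh with ⟨⟨h1, h2⟩, h3⟩ | ⟨h3, h1, h2⟩
          · exact ⟨l, i, k, j, by grind, h1, by grind, Or.inr ⟨rfl, hi, hk, hj⟩⟩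
          · exact ⟨i, l, j, k, h1, by grind, by grind, Or.inl ⟨hi, rfl, hj, hk⟩⟩
    rw [segment_arrive, segment_arrive, if_congr key rfl rfl]
    by_cases h1 : i < k ∧ k ≤ j <;> by_cases h2 : i < l ∧ l ≤ j <;>
      simp [h1, h2]; rfl
  -- On different circuits the segment misses `p` and `q`, and interlacement would need a common
  -- circuit.
  · rw [segment_arrive_of_ne hdc, segment_arrive_of_ne hdc, if_neg, add_zero]
    rintro ⟨-, b, hb, x, y, z, w, -, -, -, hvis⟩
    have : ∃ m m', b.visit m = v ∧ b.visit m' = d.1.visit l := by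
      rcases hvis with hh | hh
      · exact ⟨x, y, hh.1, hh.2.1⟩
      · exact ⟨y, x, hh.2.1, hh.1⟩
    obtain ⟨m, m', hm, hm'⟩ := this
    have h1 : (⟨b, hb⟩ : C.toCircuitPartition.circuits) = c := by
      rcases atv hb hm with h | h <;> exact congrArg (fun r => r.1) h
    have h2 : (⟨b, hb⟩ : C.toCircuitPartition.circuits) = d := by
      rcases atw hb hm' with h | h <;> exact congrArg (fun r => r.1) h
    exact hdc (h2.symm.trans h1)

/-- The rows of the modified interlacement matrix are images of segments of the circuits of the
Euler system. -/
theorem modifiedMatrix_eq_turn (hG : G.IsRegular 4) (P : CircuitPartition G)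
    (c : C.toCircuitPartition.circuits) {i j : Fin (c.1.n + 1)} (hij : i < j) {v : V}
    (hi : c.1.visit i = v) (hj : c.1.visit j = v) :
    C.modifiedMatrix P v = turn hG P (c.1.segment i j) := by
  classical
  funext w
  have hz := segment_mem_evenSpace hG c hij hi hj
  by_cases hvw : v = w
  · subst hvw
    have hne : (⟨c, i⟩ : C.toCircuitPartition.Passage) ≠ ⟨c, j⟩ := fun he =>
      hij.ne (eq_of_heq (Sigma.mk.inj he).2)
    have key := turn_eq_ite hG P hz hne (hi.trans hj.symm)
    -- Diagonal entry: the segment has value 0 on the arrival and 1 on the departure at `i`, and 1,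
    -- 0 at `j`. The transitions φ, ψ and the third one thus give 1, 1 and 0.
    rw [segment_arrive, segment_arrive, segment_leave, segment_leave] at key
    have hj' : Passage.vertex (P := C.toCircuitPartition) ⟨c, j⟩ = v := hj
    rw [hj'] at key
    rw [key]
    simp [modifiedMatrix, interlacementMatrix, Interlaced, hij]
  · obtain ⟨p, q, hpq, hp, rfl, -⟩ := Passage.exists_pair hG C.toCircuitPartition w
    -- Off the diagonal arrival and departure agree, so φ gives 0 and the other two transitions both
    -- give the interlacement entry.
    rw [turn_eq_ite hG P hz hpq hp,
      ← segment_arrive_eq_leave c hi hj p (by rw [hp]; exact Ne.symm hvw),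
      ← segment_arrive_eq_leave c hi hj q (Ne.symm hvw),
      ← interlacementMatrix_eq_segment hG c hij hi hj hpq hp hvw, CharTwo.add_self_eq_zero]
    simp [modifiedMatrix, hvw]

/-! ### The product formula over GF(2) -/

theorem modifiedMatrix_self (C : EulerSystem G) [DecidableEq V] :
    C.modifiedMatrix C.toCircuitPartition = 1 := by
  ext v w
  simp [modifiedMatrix, phi, Matrix.one_apply]

/-- An even edge vector with no turns on an Euler system has no turns on any circuit
partition. -/
theorem turn_eq_zero (hG : G.IsRegular 4) (P : CircuitPartition G) {z : E → ZMod 2}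
    (hz : z ∈ evenSpace hG) (h : turn hG C.toCircuitPartition z = 0) : turn hG P z = 0 := by
  have step (p : C.toCircuitPartition.Passage) : z (G.edge p.arrive) = z (G.edge p.leave) := by
    have := turn_apply hG hz p
    rw [h] at this
    exact CharTwo.add_eq_zero.1 this.symm
  have const (c : C.toCircuitPartition.circuits) (k : Fin (c.1.n + 1)) :
      z (G.edge (c.1.start k)) = z (G.edge (c.1.start 0)) := by
    induction k using Fin.induction with
    | zero => rfl
    | succ k ih =>
      rw [← ih, c.1.edge_eq k.castSucc]
      have := step ⟨c, k.castSucc⟩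
      rw [← Fin.coeSucc_eq_succ]
      exact this.symm
  have val (p : C.toCircuitPartition.Passage) (x : H) (hx : x = p.arrive ∨ x = p.leave) :
      z (G.edge x) = z (G.edge (p.1.1.start 0)) := by
    rcases hx with rfl | rfl
    · rw [step]; exact const _ _
    · exact const _ _
  funext w
  obtain ⟨r, -, -, rfl, -, -⟩ := Passage.exists_pair hG P w
  rw [turn_apply hG hz]
  -- Both half-edges of `r` lie at one vertex, hence on a single circuit of `C`, where `z` is
  -- constant.
  obtain ⟨p, hp⟩ := Passage.exists_arrive_or_leave (P := C.toCircuitPartition) r.arrive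
  obtain ⟨q, hq⟩ := Passage.exists_arrive_or_leave (P := C.toCircuitPartition) r.leave
  have hpv : p.vertex = r.vertex := by
    rw [← Passage.vert_arrive r]
    rcases hp with hp | hp <;> rw [← hp]
    · rfl
    · exact (Passage.vert_leave p).symm
  have hqv : q.vertex = r.vertex := by
    rw [← Passage.vert_leave r]
    rcases hq with hq | hq <;> rw [← hq]
    · rfl
    · exact (Passage.vert_leave q).symm
  rw [val p r.arrive (hp.imp Eq.symm Eq.symm), val q r.leave (hq.imp Eq.symm Eq.symm),
    circuit_eq (hpv.trans hqv.symm), CharTwo.add_self_eq_zero]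
  rfl

/-- Segments of `C` have the unit vectors as turns on `C`, so a combination `y` of them has the same
turns on `C` as `z`; the difference is invisible to every `P`. -/
theorem turn_eq_vecMul [Fintype V] (hG : G.IsRegular 4) (C : EulerSystem G)
    (P : CircuitPartition G) {z : E → ZMod 2} (hz : z ∈ evenSpace hG) :
    turn hG P z = Matrix.vecMul (turn hG C.toCircuitPartition z) (C.modifiedMatrix P) := by
  classical
  choose c i j hij hi hj _ using exists_visits hG C
  have row (Q : CircuitPartition G) (v : V) :=
    modifiedMatrix_eq_turn hG Q (c v) (hij v) (hi v) (hj v)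
  set y : E → ZMod 2 := ∑ v, turn hG C.toCircuitPartition z v • (c v).1.segment (i v) (j v)
    with hy
  have hye : y ∈ evenSpace hG := Submodule.sum_mem _ fun v _ =>
    Submodule.smul_mem _ _ (segment_mem_evenSpace hG (c v) (hij v) (hi v) (hj v))
  have hQ (Q : CircuitPartition G) : turn hG Q y =
      Matrix.vecMul (turn hG C.toCircuitPartition z) (C.modifiedMatrix Q) := by
    rw [hy, map_sum, Matrix.vecMul_eq_sum]
    exact Finset.sum_congr rfl fun v _ => by rw [map_smul, row Q v]
  rw [← hQ, ← sub_eq_zero, ← map_sub]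
  refine turn_eq_zero (C := C) hG P (Submodule.sub_mem _ hz hye) ?_
  rw [map_sub, hQ, modifiedMatrix_self, Matrix.vecMul_one, sub_self]

theorem modifiedMatrix_mul [Fintype V] (hG : G.IsRegular 4) (C C' : EulerSystem G)
    (P : CircuitPartition G) :
    C'.modifiedMatrix C.toCircuitPartition * C.modifiedMatrix P = C'.modifiedMatrix P := by
  ext v w
  obtain ⟨c, i, j, hij, hi, hj, -⟩ := exists_visits hG C' v
  rw [Matrix.mul_apply_eq_vecMul, modifiedMatrix_eq_turn hG _ c hij hi hj,
    modifiedMatrix_eq_turn hG _ c hij hi hj,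
    ← turn_eq_vecMul hG C P (segment_mem_evenSpace hG c hij hi hj)]

/-! ### Cycle spaces and real matrices -/

/-- The edges of the touch-graph of an Euler system are loops. -/
theorem cycleSpace_touchGraph (hG : G.IsRegular 4) (K : Type*) [Field K] [Fintype V]
    (D : (C.toCircuitPartition.touchGraph hG).Direction) : cycleSpace K D = ⊤ := by
  classical
  rw [eq_top_iff, ← (Pi.basisFun K V).span_eq, Submodule.span_le]
  rintro _ ⟨v, rfl⟩
  have hD : (D.init v).vertex = v := D.edge_init v
  obtain ⟨q, hq, hv⟩ := Passage.exists_ne hG (D.init v)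
  -- One turn around the loop `v` in the direction of `D`; its vector is the unit vector at `v`.
  let W : (C.toCircuitPartition.touchGraph hG).ClosedWalk :=
    { n := 0
      start := fun _ => D.init v
      finish := fun _ => q
      ne := fun _ => hq
      edge_eq := fun _ => hv
      vert_eq := fun _ => (circuit_eq hv).symm }
  refine Submodule.subset_span ⟨W, ?_⟩
  funext e
  have hsum : ClosedWalk.vec K D W e =
      (if D.init v = D.init e then 1 else 0) - (if q = D.init e then 1 else 0) :=
    Fin.sum_univ_one _
  rw [hsum, Pi.basisFun_apply]
  have he : (D.init e).vertex = e := D.edge_init e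
  by_cases hev : e = v
  · subst hev
    simp [hq.symm]
  · rw [if_neg, if_neg, Pi.single_eq_of_ne hev, sub_zero]
    · rintro rfl
      exact hev (he.symm.trans (hv.symm.trans hD))
    · intro h
      rw [h] at hD
      exact hev (he.symm.trans hD)

end EulerSystem

end HalfEdgeGraph

theorem Matrix.span_range_row_mul {n K : Type*} [Fintype n] [DecidableEq n] [Field K]
    {M : Matrix n n K} (hM : IsUnit M) (N : Matrix n n K) :
    Submodule.span K (Set.range (M * N).row) = Submodule.span K (Set.range N.row) := by
  rw [← range_vecMulLinear, ← range_vecMulLinear,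
    show (M * N).vecMulLinear = N.vecMulLinear ∘ₗ M.vecMulLinear from
      LinearMap.ext fun x => (Matrix.vecMul_vecMul x M N).symm]
  exact LinearMap.range_comp_of_range_eq_top _
    (LinearMap.range_eq_top.2 (Matrix.vecMul_surjective_iff_isUnit.2 hM))

theorem Matrix.isUnit_iff_span_row_eq_top {n K : Type*} [Fintype n] [DecidableEq n] [Field K]
    {M : Matrix n n K} : IsUnit M ↔ Submodule.span K (Set.range M.row) = ⊤ := by
  rw [← range_vecMulLinear, LinearMap.range_eq_top]
  exact Matrix.vecMul_surjective_iff_isUnit.symm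

theorem mainTheorem3 {V E H : Type*} [Fintype V] [DecidableEq V]
    (F : HalfEdgeGraph V E H) (hF : F.IsRegular 4) (C C' : F.EulerSystem) :
    (∀ (D' : (C'.toCircuitPartition.touchGraph hF).Direction) (M : Matrix V V ℝ),
      HalfEdgeGraph.EulerSystem.IsRealMatrix hF C C'.toCircuitPartition D' M →
        IsUnit M ∧
        ∀ D : (C.toCircuitPartition.touchGraph hF).Direction,
          HalfEdgeGraph.EulerSystem.IsRealMatrix hF C' C.toCircuitPartition D (M.det • M⁻¹)) ∧
    (∀ (P : F.CircuitPartition)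
      (D : (C.toCircuitPartition.touchGraph hF).Direction) (DP : (P.touchGraph hF).Direction)
      (M N : Matrix V V ℝ),
      HalfEdgeGraph.EulerSystem.IsRealMatrix hF C' C.toCircuitPartition D M →
        HalfEdgeGraph.EulerSystem.IsRealMatrix hF C P DP N →
          HalfEdgeGraph.EulerSystem.IsRealMatrix hF C' P DP (M * N)) := by
  classical
  open HalfEdgeGraph EulerSystem in
  have unit (A B : F.EulerSystem) (D : (B.toCircuitPartition.touchGraph hF).Direction)
      (M : Matrix V V ℝ) (h : IsRealMatrix hF A B.toCircuitPartition D M) : IsUnit M := by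
    rw [Matrix.isUnit_iff_span_row_eq_top, h.2, cycleSpace_touchGraph]
  refine ⟨fun D' M hM => ⟨unit C C' D' M hM, fun D => ?_⟩, ?_⟩
  · have hu := unit C C' D' M hM
    have hdet : IsUnit M.det := (Matrix.isUnit_iff_isUnit_det M).1 hu
    -- The adjugate commutes with ring homomorphisms, so it carries both integrality and the
    -- reduction modulo 2.
    have hadj : M.det • M⁻¹ = M.adjugate := by
      rw [Matrix.inv_def, smul_smul, Ring.mul_inverse_cancel _ hdet, one_smul]
    obtain ⟨⟨N, hN, hN2⟩, -⟩ := hM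
    refine ⟨⟨N.adjugate, ?_, ?_⟩, ?_⟩
    · rw [hadj, ← hN]
      exact (Int.castRingHom ℝ).map_adjugate N
    · have h1 : N.adjugate.map (Int.cast : ℤ → ZMod 2) =
          (C.modifiedMatrix C'.toCircuitPartition).adjugate := by
        rw [← hN2]
        exact (Int.castRingHom (ZMod 2)).map_adjugate N
      have hinv := HalfEdgeGraph.EulerSystem.modifiedMatrix_mul hF C' C C.toCircuitPartition
      rw [HalfEdgeGraph.EulerSystem.modifiedMatrix_self] at hinv
      -- The only unit of GF(2) is 1, so the adjugate modulo 2 is the inverse itself.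
      have hd : (C.modifiedMatrix C'.toCircuitPartition).det = 1 := by
        have h2 : IsUnit (C.modifiedMatrix C'.toCircuitPartition).det :=
          Matrix.isUnit_det_of_right_inverse hinv
        have key (a : ZMod 2) (ha : a ≠ 0) : a = 1 := by revert a; decide
        exact key _ h2.ne_zero
      rw [h1, ← mul_one (Matrix.adjugate _), ← hinv, ← mul_assoc, Matrix.adjugate_mul, hd,
        one_smul, one_mul]
    · rw [HalfEdgeGraph.EulerSystem.cycleSpace_touchGraph, ← Matrix.isUnit_iff_span_row_eq_top,
        Matrix.isUnit_iff_isUnit_det, hadj, Matrix.det_adjugate]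
      exact hdet.pow _
  · rintro P D DP M N hM hN
    have hu := unit C' C D M hM
    obtain ⟨⟨M', hM1, hM2⟩, -⟩ := hM
    obtain ⟨⟨N', hN1, hN2⟩, hN3⟩ := hN
    refine ⟨⟨M' * N', ?_, ?_⟩, ?_⟩
    · rw [← hM1, ← hN1]
      exact Matrix.map_mul (f := Int.castRingHom ℝ)
    · rw [← HalfEdgeGraph.EulerSystem.modifiedMatrix_mul hF C C' P, ← hM2, ← hN2]
      exact Matrix.map_mul (f := Int.castRingHom (ZMod 2))
    · rw [Matrix.span_range_row_mul hu, hN3]
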